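/- All graphs are finite, undirected, simple and loopless. For a graph $G=(V,E)$ and $S\subseteq V$ let $N(S)=\bigl(\bigcup_{x\in S}N(x)\bigr)\setminus S$. For a real number $c>0$, $G$ is a *$c$-expander* if $|N(S)|\ge c\,|S|$ for every $S\subseteq V$ with $|S|\le |V|/2$. A *chordal completion* of $G$ is a chordal graph $H=(V,E')$ with $E\subseteq E'$ (chordal: every cycle of length at least $4$ has a chord). For every real number $c>0$ there is a real number $K>0$, depending only on $c$, such that for every $n\ge 2$ and every $c$-expander $G$ on $n$ vertices: 1. the treewidth of $G$ is at least $K\,n$; 2. every chordal completion $H$ of $G$ contains a clique with at least $K\,n$ vertices; 3. every chordal completion $H$ of $G$ has at least $K\,n^2$ edges. -/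

import Mathlib

universe u

namespace ChordalLB

/-- The outer neighbourhood `N(S) = (⋃ x ∈ S, N(x)) \ S` of a vertex set `S`. -/
def outerNbhd {V : Type u} (G : SimpleGraph V) (S : Set V) : Set V :=
  (⋃ x ∈ S, G.neighborSet x) \ S

/-- `G` is a (vertex) `c`-expander: `|N(S)| ≥ c |S|` for every `S` with `|S| ≤ |V| / 2`. -/
def IsExpander {V : Type u} [Fintype V] (G : SimpleGraph V) (c : ℝ) : Prop :=
  ∀ S : Finset V, (S.card : ℝ) ≤ (Fintype.card V : ℝ) / 2 →
    c * (S.card : ℝ) ≤ ((outerNbhd G (S : Set V)).ncard : ℝ)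

/-- A graph is chordal if every cycle of length at least `4` has a chord, that is, an edge of the
graph that joins two vertices of the cycle and is not an edge of the cycle. -/
def IsChordal {V : Type u} (G : SimpleGraph V) : Prop :=
  ∀ (v : V) (p : G.Walk v v), p.IsCycle → 4 ≤ p.length →
    ∃ x ∈ p.support, ∃ y ∈ p.support, G.Adj x y ∧ s(x, y) ∉ p.edges

/-- `H` is a chordal completion of `G`: a chordal graph on the same vertices, obtained from `G` by
adding (possibly no) edges. -/
def IsChordalCompletion {V : Type u} (G H : SimpleGraph V) : Prop :=
  G ≤ H ∧ IsChordal H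

/-- The graph `T` together with the bags `bag t` is a tree decomposition of `G`. -/
structure IsTreeDecomposition {V : Type u} (G : SimpleGraph V) {ι : Type}
    (T : SimpleGraph ι) (bag : ι → Finset V) : Prop where
  isTree : T.IsTree
  vertex_mem : ∀ v : V, ∃ t, v ∈ bag t
  edge_mem : ∀ v w : V, G.Adj v w → ∃ t, v ∈ bag t ∧ w ∈ bag t
  connected : ∀ v : V, (T.induce {t | v ∈ bag t}).Preconnected

/-- `G` has a tree decomposition (over a finite tree) of width at most `w`, that is, with all bags
of size at most `w + 1`. -/
def HasTreeDecompositionOfWidth {V : Type u} (G : SimpleGraph V) (w : ℕ) : Prop :=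
  ∃ (m : ℕ) (T : SimpleGraph (Fin m)) (bag : Fin m → Finset V),
    IsTreeDecomposition G T bag ∧ ∀ t, (bag t).card ≤ w + 1

/-- The treewidth of a finite graph: the least width of a tree decomposition (with the value `0`
for the graph without vertices). -/
noncomputable def treewidth {V : Type u} (G : SimpleGraph V) : ℕ :=
  sInf {w : ℕ | HasTreeDecompositionOfWidth G w}

/-- A finite graph has some tree decomposition, so the infimum defining `treewidth` is attained. -/
theorem exists_hasTreeDecompositionOfWidth {V : Type u} [Fintype V] (G : SimpleGraph V) :
    ∃ w : ℕ, HasTreeDecompositionOfWidth G w := by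
  refine ⟨Fintype.card V, 1, ⊥, fun _ => Finset.univ, ⟨?_, ?_, ?_, ?_⟩, ?_⟩
  · exact SimpleGraph.IsTree.of_subsingleton
  · exact fun v => ⟨0, Finset.mem_univ v⟩
  · exact fun v w _ => ⟨0, Finset.mem_univ v, Finset.mem_univ w⟩
  · exact fun v => SimpleGraph.Preconnected.of_subsingleton
  · intro t
    simp

end ChordalLB

/-!
In a `c`-expander a balanced separator has linear size: a suitable union of components of its
complement has at most half of the vertices, has all its outer neighbours in the separator, and
either has at least a quarter of the vertices or is the whole complement. On the other hand, a
hereditary family of vertex sets contains a balanced separator as soon as it contains the edges and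
the outer neighbourhood of a connected set can be enlarged within the family by a vertex of that
set. The cliques of a chordal graph form such a family, and so do the sets contained in a bag of a
tree decomposition; hence some clique and some bag have linear size, and such a clique has
quadratically many edges.
-/

namespace ChordalLB

open SimpleGraph

section Walks

variable {V : Type*} {G : SimpleGraph V}

lemma exists_isPath_support_subset {C : Set V} (hC : (G.induce C).Preconnected) {a b : V}
    (ha : a ∈ C) (hb : b ∈ C) : ∃ p : G.Walk a b, p.IsPath ∧ ∀ z ∈ p.support, z ∈ C := by
  obtain ⟨p, hp⟩ := hC.exists_isPath ⟨a, ha⟩ ⟨b, hb⟩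
  refine ⟨p.map (Embedding.induce C).toHom, hp.map Subtype.val_injective,
    fun z hz => ?_⟩
  obtain ⟨y, -, rfl⟩ := List.mem_map.1 (Walk.support_map _ p ▸ hz)
  exact y.2

lemma exists_isPath_end_first_mem {u v : V} (p : G.Walk u v) {S : Set V} (hv : v ∈ S) :
    ∃ w ∈ S, ∃ q : G.Walk u w, q.IsPath ∧ q.support ⊆ p.support ∧
      ∀ z ∈ q.support, z ∈ S → z = w := by
  classical
  induction p with
  | nil => exact ⟨_, hv, Walk.nil, by simp, by simp, by simp⟩
  | @cons u _ _ huv p ih =>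
    by_cases hu : u ∈ S
    · exact ⟨u, hu, Walk.nil, by simp, by simp, by simp⟩
    obtain ⟨w, hw, q, -, hqp, hqS⟩ := ih hv
    refine ⟨w, hw, (Walk.cons huv q).bypass, Walk.bypass_isPath _,
      fun z hz => ?_, fun z hz hzS => ?_⟩ <;>
    rcases List.mem_cons.1 (Walk.support_bypass_subset_support _ hz) with rfl | hz
    · simp
    · exact List.mem_cons_of_mem _ (hqp hz)
    · exact absurd hzS hu
    · exact hqS z hz hzS

lemma exists_shorter_isPath_of_isChord {u v : V} {p : G.Walk u v} (hp : p.IsPath) {e : Sym2 V}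
    (he : p.IsChord e) :
    ∃ q : G.Walk u v, q.IsPath ∧ q.support ⊆ p.support ∧ q.length < p.length ∧ e ∈ q.edges := by
  induction e with | _ a b
  obtain ⟨-, -, ha, hb⟩ := Walk.isChord_sym2Mk.1 he
  obtain ⟨i, rfl, hi⟩ := Walk.mem_support_iff_exists_getVert.1 ha
  obtain ⟨j, rfl, hj⟩ := Walk.mem_support_iff_exists_getVert.1 hb
  clear ha hb
  wlog hij : i ≤ j generalizing i j
  · rw [Sym2.eq_swap] at he ⊢
    exact this j hj i hi he (le_of_not_ge hij)
  obtain ⟨hab, hne, -, -⟩ := Walk.isChord_sym2Mk.1 he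
  have hij_ne : i ≠ j := by
    rintro rfl
    exact hab.ne rfl
  have hij_succ : i + 1 ≠ j := by
    rintro rfl
    exact hne ((p.mk_mem_edges_iff_exists).2 ⟨i, hj, rfl⟩)
  have hsub : ((p.take i).append (Walk.cons hab (p.drop j))).support.Sublist p.support := by
    rw [Walk.support_append, Walk.support_cons, List.tail_cons, Walk.support_take,
      Walk.drop_support_eq_support_drop_min, min_eq_left hj]
    conv_rhs => rw [← List.take_append_drop (i + 1) p.support]
    exact (List.Sublist.refl _).append (List.drop_sublist_drop_left _ (by omega))
  refine ⟨(p.take i).append (Walk.cons hab (p.drop j)), ?_, hsub.subset, ?_, ?_⟩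
  · exact Walk.IsPath.mk' (hsub.nodup hp.support_nodup)
  · simp only [Walk.length_append, Walk.take_length, Walk.length_cons, Walk.drop_length]
    omega
  · simp

end Walks

section ConnectedSets

variable {V : Type*} {G : SimpleGraph V}

lemma mem_outerNbhd {C : Set V} {x : V} :
    x ∈ outerNbhd G C ↔ (∃ a ∈ C, G.Adj a x) ∧ x ∉ C := by
  simp [outerNbhd]

lemma outerNbhd_union_subset {C D : Set V} :
    outerNbhd G (C ∪ D) ⊆ outerNbhd G C ∪ outerNbhd G D := by
  intro x hx
  obtain ⟨⟨a, ha | ha, hax⟩, hxCD⟩ := mem_outerNbhd.1 hx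
  · exact Or.inl (mem_outerNbhd.2 ⟨⟨a, ha, hax⟩, fun h => hxCD (Or.inl h)⟩)
  · exact Or.inr (mem_outerNbhd.2 ⟨⟨a, ha, hax⟩, fun h => hxCD (Or.inr h)⟩)

lemma subset_of_disjoint_outerNbhd {C D : Set V} (hD : (G.induce D).Preconnected)
    (hCD : (C ∩ D).Nonempty) (hdisj : Disjoint D (outerNbhd G C)) : D ⊆ C := by
  obtain ⟨a, haC, haD⟩ := hCD
  intro b hbD
  by_contra hbC
  obtain ⟨p, -, hp⟩ := exists_isPath_support_subset hD haD hbD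
  obtain ⟨d, hd, hdC, hdC'⟩ := p.exists_boundary_dart C haC hbC
  exact hdisj.notMem_of_mem_left (hp _ (p.dart_snd_mem_support_of_mem_darts hd))
    (mem_outerNbhd.2 ⟨⟨d.fst, hdC, d.adj⟩, hdC'⟩)

lemma exists_connected_outerNbhd_subset [Finite V] {X D : Set V} (hD : (G.induce D).Connected)
    (hDX : Disjoint D X) :
    ∃ C, D ⊆ C ∧ (G.induce C).Connected ∧ Disjoint C X ∧ outerNbhd G C ⊆ X := by
  obtain ⟨C, hDC, ⟨hC, hCX⟩, hmax⟩ := exists_maximal_ge_of_wellFoundedGT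
    (fun C : Set V => (G.induce C).Connected ∧ Disjoint C X) D ⟨hD, hDX⟩
  refine ⟨C, hDC, hC, hCX, fun x hx => ?_⟩
  obtain ⟨⟨a, haC, hax⟩, hxC⟩ := mem_outerNbhd.1 hx
  by_contra hxX
  have hCx : (G.induce (C ∪ {x})).Connected := connected_induce_union hC.preconnected
    .of_subsingleton haC (Set.mem_singleton x) hax
  have hCxX : Disjoint (C ∪ {x}) X := hCX.union_left (Set.disjoint_singleton_left.2 hxX)
  exact hxC (hmax ⟨hCx, hCxX⟩ Set.subset_union_left (Set.mem_union_right C rfl))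

end ConnectedSets

section Separators

variable {V : Type*} {G : SimpleGraph V}

/-- `X` is a balanced separator of `G`: every connected set of vertices avoiding `X`, hence every
component of `G - X`, contains at most half of the vertices. -/
def IsBalancedSeparator (G : SimpleGraph V) (X : Set V) : Prop :=
  ∀ D : Set V, (G.induce D).Connected → Disjoint D X → 2 * D.ncard ≤ Nat.card V

/-- A hereditary family of vertex sets which contains the edges of `G` and in which the outer
neighbourhood of a connected set `C`, when it belongs to the family, can be enlarged by a vertex
of `C`. The cliques of a chordal graph form such a family, and so do the sets contained in a bag
of a tree decomposition. -/
structure IsExtendable (G : SimpleGraph V) (P : Set (Set V)) : Prop where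
  empty_mem : ∅ ∈ P
  pair_mem : ∀ v w, G.Adj v w → {v, w} ∈ P
  isLowerSet : IsLowerSet P
  exists_insert_mem : ∀ C, (G.induce C).Connected → outerNbhd G C ∈ P →
    ∃ v ∈ C, insert v (outerNbhd G C) ∈ P

/-- Otherwise, let `C` be a smallest connected set with more than half of the vertices whose outer
neighbourhood is in the family. Adding a vertex `v` of `C` to that neighbourhood yields a member of
the family, and a large component avoiding it lies inside `C \ {v}`. -/
theorem IsExtendable.exists_isBalancedSeparator [Finite V] {P : Set (Set V)}
    (hP : IsExtendable G P) : ∃ X ∈ P, IsBalancedSeparator G X := by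
  by_contra! hno
  have hlarge : ∀ X ∈ P, ∃ C, (G.induce C).Connected ∧ Disjoint C X ∧ outerNbhd G C ∈ P ∧
      Nat.card V < 2 * C.ncard := by
    intro X hX
    obtain ⟨D, hD, hDX, hDn⟩ : ∃ D : Set V, (G.induce D).Connected ∧ Disjoint D X ∧
        Nat.card V < 2 * D.ncard := by
      simpa [IsBalancedSeparator] using hno X hX
    obtain ⟨C, hDC, hC, hCX, hCN⟩ := exists_connected_outerNbhd_subset hD hDX
    have := Set.ncard_le_ncard hDC
    exact ⟨C, hC, hCX, hP.isLowerSet hCN hX, by omega⟩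
  obtain ⟨C₀, hC₀, -, hC₀P, hC₀n⟩ := hlarge ∅ hP.empty_mem
  obtain ⟨C, ⟨hC, hCP, hCn⟩, hmin⟩ := exists_minimal_of_wellFoundedLT
    (fun C : Set V => (G.induce C).Connected ∧ outerNbhd G C ∈ P ∧ Nat.card V < 2 * C.ncard)
    ⟨C₀, hC₀, hC₀P, hC₀n⟩
  obtain ⟨v, hvC, hvP⟩ := hP.exists_insert_mem C hC hCP
  obtain ⟨D, hD, hDX, hDP, hDn⟩ := hlarge _ hvP
  rw [Set.disjoint_insert_right] at hDX
  have hCD : (C ∩ D).Nonempty := by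
    rw [← Set.not_disjoint_iff_nonempty_inter]
    intro hdisj
    have hle := Set.ncard_le_card (C ∪ D)
    rw [Set.ncard_union_eq hdisj] at hle
    omega
  exact hDX.1 (hmin ⟨hD, hDP, hDn⟩ (subset_of_disjoint_outerNbhd hD.preconnected hCD hDX.2) hvC)

/-- Adding a further component `D` to a largest union `A` of components of `G - X` that has at most
half of the vertices exceeds that half, so `A` or `D` has at least a quarter of them. -/
lemma IsBalancedSeparator.exists_quarter_or_compl [Finite V] {X : Set V}
    (hX : IsBalancedSeparator G X) :
    ∃ A : Set V, outerNbhd G A ⊆ X ∧ 2 * A.ncard ≤ Nat.card V ∧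
      (Nat.card V ≤ 4 * A.ncard ∨ A = Xᶜ) := by
  obtain ⟨A, ⟨hAX, hAN, hAn⟩, hmax⟩ := exists_maximal_of_wellFoundedGT
    (fun A : Set V => A ⊆ Xᶜ ∧ outerNbhd G A ⊆ X ∧ 2 * A.ncard ≤ Nat.card V)
    ⟨∅, by simp, by simp [outerNbhd], by simp⟩
  by_cases hA : Xᶜ ⊆ A
  · exact ⟨A, hAN, hAn, Or.inr (hAX.antisymm hA)⟩
  obtain ⟨u, huX, huA⟩ := Set.not_subset.1 hA
  obtain ⟨D, huD, hD, hDX, hDN⟩ := exists_connected_outerNbhd_subset (G := G) (D := {u}) (X := X)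
    ⟨.of_subsingleton⟩ (Set.disjoint_singleton_left.2 huX)
  have hADN : outerNbhd G (A ∪ D) ⊆ X :=
    outerNbhd_union_subset.trans (Set.union_subset hAN hDN)
  have hADn : Nat.card V < 2 * (A ∪ D).ncard := by
    by_contra! hle
    exact huA (hmax ⟨Set.union_subset hAX hDX.subset_compl_right, hADN, hle⟩
      Set.subset_union_left (Or.inr (huD rfl)))
  have hle := Set.ncard_union_le A D
  have hDn := hX D hD hDX
  rcases le_total (4 * A.ncard) (Nat.card V) with hAn' | hAn'
  · exact ⟨D, hDN, hDn, Or.inl (by omega)⟩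
  · exact ⟨A, hAN, hAn, Or.inl hAn'⟩

end Separators

section Chordal

variable {V : Type*} {H : SimpleGraph V}

/-- Shortcutting a path along chords of the cycle closed by `s(u, v)` shrinks that cycle to a
triangle. -/
lemma IsChordal.exists_mem_support_adj_adj (hH : IsChordal H) {u v : V} (huv : H.Adj u v)
    {p : H.Walk u v} (hp : p.IsPath) (hlen : 2 ≤ p.length) :
    ∃ w ∈ p.support, H.Adj u w ∧ H.Adj w v := by
  induction hn : p.length using Nat.strong_induction_on generalizing p with
  | _ n ih =>
  subst hn
  have huvp : s(v, u) ∉ p.edges := fun h =>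
    absurd (hp.length_eq_one_of_mem_edges (Sym2.eq_swap ▸ h)) (by omega)
  obtain hlen | hlen := hlen.eq_or_lt
  · match p, hlen with
    | .cons huw (.cons hwv .nil), _ => exact ⟨_, by simp, huw, hwv⟩
  obtain ⟨a, ha, b, hb, hab, he⟩ := hH v (Walk.cons huv.symm p)
    ((Walk.cons_isCycle_iff p huv.symm).2 ⟨hp, huvp⟩) (by rw [Walk.length_cons]; omega)
  simp only [Walk.edges_cons, List.mem_cons, not_or, Sym2.eq_swap (a := v)] at he
  have hmem : ∀ z ∈ (Walk.cons huv.symm p).support, z ∈ p.support := by simp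
  obtain ⟨q, hq, hqp, hlt, heq⟩ := exists_shorter_isPath_of_isChord hp
    (Walk.isChord_sym2Mk.2 ⟨hab, he.2, hmem a ha, hmem b hb⟩)
  have hq2 : 2 ≤ q.length := by
    match q, heq with
    | .nil, _ => exact absurd rfl huv.ne
    | .cons _ .nil, heq => exact absurd (by simpa using heq) he.1
    | .cons _ (.cons _ _), _ => simp
  obtain ⟨w, hw, huw, hwv⟩ := ih q.length hlt hq hq2 rfl
  exact ⟨w, hqp hw, huw, hwv⟩

lemma IsChordal.exists_mem_support_adj_adj_of_adj_ends (hH : IsChordal H) {a b u v : V}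
    {q : H.Walk a b} (hq : q.IsPath) (hu : u ∉ q.support) (hv : v ∉ q.support)
    (huv : H.Adj u v) (hau : H.Adj a u) (hbv : H.Adj b v) :
    ∃ w ∈ q.support, H.Adj w u ∧ H.Adj w v := by
  have hpath : (Walk.cons hau.symm (q.concat hbv)).IsPath := by
    rw [Walk.cons_isPath_iff, Walk.concat_isPath_iff, Walk.support_concat]
    exact ⟨⟨hq, hv⟩, by simp [hu, huv.ne]⟩
  obtain ⟨w, hw, huw, hwv⟩ := hH.exists_mem_support_adj_adj huv hpath (by simp)
  exact ⟨w, by simpa [Walk.support_concat, huw.ne', hwv.ne] using hw, huw.symm, hwv⟩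

/-- On a path in `C` from a common neighbour `v` of `X` to a neighbour of `x`, the first neighbour
of `x` is adjacent to all of `insert x X`. -/
lemma IsChordal.exists_forall_adj_of_isClique (hH : IsChordal H) {C : Set V}
    (hC : (H.induce C).Connected) {X : Finset V} (hX : H.IsClique (X : Set V))
    (hXC : (X : Set V) ⊆ outerNbhd H C) : ∃ v ∈ C, ∀ x ∈ X, H.Adj v x := by
  classical
  induction X using Finset.induction_on with
  | empty =>
    obtain ⟨v, hv⟩ := hC.nonempty
    exact ⟨v, hv, by simp⟩
  | @insert x X hxX ih =>
    rw [Finset.coe_insert] at hX hXC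
    rw [isClique_insert_of_notMem hxX] at hX
    rw [Set.insert_subset_iff] at hXC
    obtain ⟨v, hvC, hv⟩ := ih hX.1 hXC.2
    obtain ⟨⟨b, hbC, hbx⟩, hxC⟩ := mem_outerNbhd.1 hXC.1
    obtain ⟨r, -, hrC⟩ := exists_isPath_support_subset hC.preconnected hvC hbC
    obtain ⟨y, hyx, q, hq, hqr, hqx⟩ := exists_isPath_end_first_mem r (S := {z | H.Adj z x}) hbx
    have hqC : ∀ z ∈ q.support, z ∈ C := fun z hz => hrC z (hqr hz)
    refine ⟨y, hqC y q.end_mem_support, (Finset.forall_mem_insert _ _ _).2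
      ⟨hyx, fun x' hx' => ?_⟩⟩
    obtain ⟨w, hw, hwx', hwx⟩ := hH.exists_mem_support_adj_adj_of_adj_ends hq
      (fun h => (mem_outerNbhd.1 (hXC.2 hx')).2 (hqC x' h)) (fun h => hxC (hqC x h))
      (hX.2 x' hx').symm (hv x' hx') hyx
    exact hqx w hw hwx ▸ hwx'

lemma IsChordal.isExtendable_isClique [Finite V] (hH : IsChordal H) :
    IsExtendable H {X | H.IsClique X} where
  empty_mem := isClique_empty
  pair_mem _ _ h := isClique_pair.2 fun _ => h
  isLowerSet _ _ hYX hX := hX.subset hYX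
  exists_insert_mem C hC hX := by
    have hfin := Set.toFinite (outerNbhd H C)
    obtain ⟨v, hvC, hv⟩ := hH.exists_forall_adj_of_isClique hC (X := hfin.toFinset)
      (by simpa using hX) (by simp)
    exact ⟨v, hvC, hX.insert fun x hx _ => hv x (hfin.mem_toFinset.2 hx)⟩

end Chordal

section TreeDecomposition

lemma support_subset_of_preconnected {ι : Type*} {T : SimpleGraph ι} (hT : T.IsAcyclic) {s t : ι}
    {p : T.Walk s t} (hp : p.IsPath) {A : Set ι} (hA : (T.induce A).Preconnected) (hs : s ∈ A)
    (ht : t ∈ A) : ∀ z ∈ p.support, z ∈ A := by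
  obtain ⟨q, hq, hqA⟩ := exists_isPath_support_subset hA hs ht
  obtain rfl : p = q := congrArg Subtype.val
    ((hT.subsingleton_path s t).elim ⟨p, hp⟩ ⟨q, hq⟩)
  exact hqA

/-- The vertex `g` is the gate of `S` as seen from `t`, the point of `S` nearest to `t`. -/
lemma exists_mem_forall_preconnected_mem {ι : Type*} {T : SimpleGraph ι} (hT : T.IsTree)
    {S : Set ι} (hS : (T.induce S).Connected) (t : ι) :
    ∃ g ∈ S, ∀ A : Set ι, (T.induce A).Preconnected → t ∈ A → (A ∩ S).Nonempty → g ∈ A := by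
  obtain ⟨s, hs⟩ := hS.nonempty
  obtain ⟨r⟩ := hT.connected.preconnected t s
  obtain ⟨g, hg, p, hp, -, hpS⟩ := exists_isPath_end_first_mem r hs
  refine ⟨g, hg, fun A hA htA ⟨a, haA, haS⟩ => ?_⟩
  obtain ⟨q, hq, hqS⟩ := exists_isPath_support_subset hS.preconnected hg haS
  have hpq : (p.append q).IsPath := by
    rw [Walk.isPath_def, Walk.support_append, List.nodup_append']
    refine ⟨hp.support_nodup, hq.support_nodup.tail, fun z hz hz' => ?_⟩
    have hzg : z = g := hpS z hz (hqS z (List.mem_of_mem_tail hz'))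
    have hgq : (g :: q.support.tail).Nodup := q.cons_tail_support ▸ hq.support_nodup
    exact (List.nodup_cons.1 hgq).1 (hzg ▸ hz')
  exact support_subset_of_preconnected hT.isAcyclic hpq hA htA haA g
    ((Walk.mem_support_append_iff _ _).2 (Or.inl p.end_mem_support))

variable {V : Type u} {G : SimpleGraph V} {ι : Type} {T : SimpleGraph ι} {bag : ι → Finset V}

lemma IsTreeDecomposition.connected_induce_bags (h : IsTreeDecomposition G T bag) {C : Set V}
    (hC : (G.induce C).Connected) : (T.induce {t | ∃ v ∈ C, v ∈ bag t}).Connected := by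
  have reachable_of_mem_bag {v : V} (hv : v ∈ C) {s t : ι} (hs : v ∈ bag s) (ht : v ∈ bag t) :
      (T.induce {t | ∃ v ∈ C, v ∈ bag t}).Reachable ⟨s, v, hv, hs⟩ ⟨t, v, hv, ht⟩ :=
    have hsub : {t | v ∈ bag t} ⊆ {t | ∃ v ∈ C, v ∈ bag t} := fun _ hr => ⟨v, hv, hr⟩
    (h.connected v ⟨s, hs⟩ ⟨t, ht⟩).map (induceHomOfLE T hsub).toHom
  have reachable_of_walk {v w : C} (p : (G.induce C).Walk v w) : ∀ {s t : ι} (hs : ↑v ∈ bag s)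
      (ht : ↑w ∈ bag t), (T.induce {t | ∃ v ∈ C, v ∈ bag t}).Reachable
        ⟨s, v, v.2, hs⟩ ⟨t, w, w.2, ht⟩ := by
    induction p with
    | nil => exact fun hs ht => reachable_of_mem_bag (Subtype.coe_prop _) hs ht
    | @cons v _ _ hadj _ ih =>
      intro s t hs ht
      obtain ⟨r, hrv, hrw⟩ := h.edge_mem _ _ hadj
      exact (reachable_of_mem_bag v.2 hs hrv).trans (ih hrw ht)
  obtain ⟨v, hv⟩ := hC.nonempty
  obtain ⟨t, ht⟩ := h.vertex_mem v
  refine (connected_iff _).2 ⟨?_, ⟨t, v, hv, ht⟩⟩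
  rintro ⟨s, v, hv, hs⟩ ⟨t, w, hw, ht⟩
  obtain ⟨p⟩ := hC.preconnected ⟨v, hv⟩ ⟨w, hw⟩
  exact reachable_of_walk p hs ht

/-- Move from the given bag to the gate of the subtree formed by the bags that meet `C`. -/
lemma IsTreeDecomposition.exists_insert_outerNbhd_subset_bag (h : IsTreeDecomposition G T bag)
    {C : Set V} (hC : (G.induce C).Connected) {t : ι} (ht : outerNbhd G C ⊆ bag t) :
    ∃ v ∈ C, ∃ g, insert v (outerNbhd G C) ⊆ bag g := by
  obtain ⟨g, ⟨v, hvC, hv⟩, hg⟩ :=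
    exists_mem_forall_preconnected_mem h.isTree (h.connected_induce_bags hC) t
  refine ⟨v, hvC, g, Set.insert_subset hv fun x hx => ?_⟩
  obtain ⟨⟨b, hbC, hbx⟩, -⟩ := mem_outerNbhd.1 hx
  obtain ⟨r, hrb, hrx⟩ := h.edge_mem _ _ hbx
  exact hg {t | x ∈ bag t} (h.connected x) (ht hx) ⟨r, hrx, b, hbC, hrb⟩

lemma IsTreeDecomposition.isExtendable_subset_bag (h : IsTreeDecomposition G T bag) :
    IsExtendable G {X | ∃ t, X ⊆ bag t} where
  empty_mem := h.isTree.connected.nonempty.elim fun t => ⟨t, Set.empty_subset _⟩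
  pair_mem v w hvw := by
    obtain ⟨t, hv, hw⟩ := h.edge_mem v w hvw
    exact ⟨t, Set.pair_subset hv hw⟩
  isLowerSet _ _ := fun hYX ⟨t, ht⟩ => ⟨t, hYX.trans ht⟩
  exists_insert_mem _ hC := fun ⟨_, ht⟩ => h.exists_insert_outerNbhd_subset_bag hC ht

end TreeDecomposition

section Expander

variable {V : Type u} [Fintype V] {G H : SimpleGraph V} {c : ℝ}

lemma IsExpander.mul_ncard_le (h : IsExpander G c) {S : Set V}
    (hS : 2 * S.ncard ≤ Fintype.card V) : c * S.ncard ≤ (outerNbhd G S).ncard := by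
  classical
  have hS' : (2 * S.ncard : ℝ) ≤ Fintype.card V := by exact_mod_cast hS
  have := h S.toFinset (by rw [← Set.ncard_eq_toFinset_card']; linarith)
  rwa [← Set.ncard_eq_toFinset_card', Set.coe_toFinset] at this

lemma IsExpander.mono (h : IsExpander G c) (hGH : G ≤ H) : IsExpander H c := by
  intro S hS
  refine (h S hS).trans (Nat.cast_le.2 (Set.ncard_le_ncard fun x hx => ?_))
  obtain ⟨⟨a, ha, hax⟩, hx⟩ := mem_outerNbhd.1 hx
  exact mem_outerNbhd.2 ⟨⟨a, ha, hGH hax⟩, hx⟩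

lemma IsExpander.exists_adj (h : IsExpander G c) (hc : 0 < c) (hn : 2 ≤ Fintype.card V) (v : V) :
    ∃ w, G.Adj v w := by
  have hle : c ≤ (outerNbhd G {v}).ncard := by simpa using h.mul_ncard_le (S := {v}) (by simpa)
  have hpos : 0 < (outerNbhd G {v}).ncard := Nat.cast_pos.1 (hc.trans_le hle)
  obtain ⟨w, hw⟩ := Set.nonempty_of_ncard_ne_zero hpos.ne'
  obtain ⟨⟨a, rfl, ha⟩, -⟩ := mem_outerNbhd.1 hw
  exact ⟨w, ha⟩

/-- The two cases give `|X| ≥ c n / 4` and `|X| ≥ c (n - |X|)`; the constant `c / (c + 4)` is below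
both `c / 4` and `c / (c + 1)`. -/
theorem IsExpander.le_ncard_of_isBalancedSeparator (h : IsExpander G c) (hc : 0 < c) {X : Set V}
    (hX : IsBalancedSeparator G X) : c / (c + 4) * Fintype.card V ≤ X.ncard := by
  obtain ⟨A, hAX, hAn, hA⟩ := hX.exists_quarter_or_compl
  rw [Nat.card_eq_fintype_card] at hAn hA
  have hAX' : c * A.ncard ≤ X.ncard :=
    (h.mul_ncard_le hAn).trans (Nat.cast_le.2 (Set.ncard_le_ncard hAX))
  rw [div_mul_eq_mul_div, div_le_iff₀ (by positivity)]
  rcases hA with hA | rfl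
  · have : (Fintype.card V : ℝ) ≤ 4 * A.ncard := by exact_mod_cast hA
    nlinarith
  · have hsum : (X.ncard + Xᶜ.ncard : ℝ) = Fintype.card V := by
      rw [← Nat.card_eq_fintype_card]
      exact_mod_cast Set.ncard_add_ncard_compl X
    nlinarith

theorem IsExpander.exists_mem_le_ncard (h : IsExpander G c) (hc : 0 < c)
    (hn : 2 ≤ Fintype.card V) {P : Set (Set V)} (hP : IsExtendable G P) :
    ∃ X ∈ P, 2 ≤ X.ncard ∧ c / (c + 4) * Fintype.card V ≤ X.ncard := by
  obtain ⟨X, hXP, hX⟩ := hP.exists_isBalancedSeparator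
  have hle := h.le_ncard_of_isBalancedSeparator hc hX
  rcases le_or_gt 2 X.ncard with hX2 | hX2
  · exact ⟨X, hXP, hX2, hle⟩
  obtain ⟨v⟩ : Nonempty V := Fintype.card_pos_iff.1 (by omega)
  obtain ⟨w, hvw⟩ := h.exists_adj hc hn v
  have hcard : ({v, w} : Set V).ncard = 2 := Set.ncard_pair hvw.ne
  exact ⟨{v, w}, hP.pair_mem v w hvw, hcard.ge, hle.trans (by rw [hcard]; exact_mod_cast hX2.le)⟩

theorem IsExpander.le_treewidth (h : IsExpander G c) (hc : 0 < c) (hn : 2 ≤ Fintype.card V) :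
    c / (c + 4) * Fintype.card V ≤ 2 * treewidth G := by
  obtain ⟨m, T, bag, hT, hw⟩ : HasTreeDecompositionOfWidth G (treewidth G) :=
    Nat.sInf_mem (exists_hasTreeDecompositionOfWidth G)
  obtain ⟨X, ⟨t, ht⟩, hX2, hX⟩ := h.exists_mem_le_ncard hc hn hT.isExtendable_subset_bag
  have hXt : X.ncard ≤ (bag t).card := Set.ncard_coe_finset (bag t) ▸ Set.ncard_le_ncard ht
  have hle : X.ncard ≤ 2 * treewidth G := by
    have := hw t
    omega
  exact hX.trans (by exact_mod_cast hle)

theorem IsExpander.exists_isClique (h : IsExpander H c) (hc : 0 < c) (hn : 2 ≤ Fintype.card V)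
    (hH : IsChordal H) :
    ∃ s : Finset V, H.IsClique (s : Set V) ∧ 2 ≤ s.card ∧
      c / (c + 4) * Fintype.card V ≤ s.card := by
  classical
  obtain ⟨X, hX, hX2, hle⟩ := h.exists_mem_le_ncard hc hn hH.isExtendable_isClique
  rw [Set.ncard_eq_toFinset_card'] at hX2 hle
  exact ⟨X.toFinset, by simpa using hX, hX2, hle⟩

end Expander

section CliqueEdges

variable {V : Type*} [Finite V] {H : SimpleGraph V} {s : Finset V}

lemma choose_two_le_ncard_edgeSet (hs : H.IsClique (s : Set V)) :
    s.card.choose 2 ≤ H.edgeSet.ncard := by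
  classical
  rw [← Sym2.card_image_offDiag, ← Set.ncard_coe_finset]
  refine Set.ncard_le_ncard fun e he => ?_
  obtain ⟨⟨a, b⟩, hab, rfl⟩ := Finset.mem_image.1 (Finset.mem_coe.1 he)
  obtain ⟨ha, hb, hne⟩ := Finset.mem_offDiag.1 hab
  exact hs ha hb hne

lemma sq_card_le_four_mul_ncard_edgeSet (hs : H.IsClique (s : Set V)) (hs2 : 2 ≤ s.card) :
    (s.card : ℝ) ^ 2 ≤ 4 * H.edgeSet.ncard := by
  have hchoose : ((s.card.choose 2 : ℕ) : ℝ) ≤ H.edgeSet.ncard :=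
    Nat.cast_le.2 (choose_two_le_ncard_edgeSet hs)
  rw [Nat.cast_choose_two] at hchoose
  have hs2' : (2 : ℝ) ≤ s.card := by exact_mod_cast hs2
  nlinarith

end CliqueEdges

end ChordalLB

theorem mainTheorem7 (c : ℝ) (hc : 0 < c) :
    ∃ K : ℝ, 0 < K ∧
      ∀ (V : Type u) [Fintype V] (G : SimpleGraph V),
        2 ≤ Fintype.card V → ChordalLB.IsExpander G c →
          K * (Fintype.card V : ℝ) ≤ (ChordalLB.treewidth G : ℝ) ∧
          ∀ H : SimpleGraph V, ChordalLB.IsChordalCompletion G H →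
            (∃ s : Finset V, H.IsClique (s : Set V) ∧ K * (Fintype.card V : ℝ) ≤ (s.card : ℝ)) ∧
            K * (Fintype.card V : ℝ) ^ 2 ≤ (H.edgeSet.ncard : ℝ) := by
  set k := c / (c + 4)
  have hk : 0 < k := by positivity
  refine ⟨min (k / 2) (k ^ 2 / 4), by positivity, fun V _ G hn hG => ⟨?_, fun H hH => ?_⟩⟩
  · calc min (k / 2) (k ^ 2 / 4) * (Fintype.card V : ℝ)
        ≤ k / 2 * Fintype.card V := by gcongr; exact min_le_left _ _
      _ ≤ ChordalLB.treewidth G := by linarith [hG.le_treewidth hc hn]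
  · obtain ⟨s, hs, hs2, hle⟩ := (hG.mono hH.1).exists_isClique hc hn hH.2
    refine ⟨⟨s, hs, ?_⟩, ?_⟩
    · calc min (k / 2) (k ^ 2 / 4) * (Fintype.card V : ℝ)
          ≤ k * Fintype.card V := by gcongr; exact (min_le_left _ _).trans (by linarith)
        _ ≤ s.card := hle
    · calc min (k / 2) (k ^ 2 / 4) * (Fintype.card V : ℝ) ^ 2
          ≤ k ^ 2 / 4 * Fintype.card V ^ 2 := by gcongr; exact min_le_right _ _
        _ = (k * Fintype.card V) ^ 2 / 4 := by ring
        _ ≤ s.card ^ 2 / 4 := by gcongr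
        _ ≤ H.edgeSet.ncard := by
          linarith [ChordalLB.sq_card_le_four_mul_ncard_edgeSet hs hs2]
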